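/- Let $\alpha>0$ be a real number. Identify a partition $\lambda$ with its Ferrers diagram $\{(i,j): 1\le i\le l(\lambda),\ 1\le j\le\lambda_i\}$, write $|\lambda|$ for its weight, $m_i(\lambda)$ for the multiplicity of $i$ as a part of $\lambda$, and put $z_\lambda=\prod_{i\ge1} i^{m_i(\lambda)}\,m_i(\lambda)!$. For an integer $r\ge 0$ let $\left\langle{\lambda\atop r}\right\rangle$ be the number of ways to choose $r$ cells in the diagram of $\lambda$ so that at least one cell is chosen in each row. For integers $j,k\ge0$ define the polynomial $$P_{jk}(X_1,X_2,\dots)=\sum_{|\mu|=j}\frac{\left\langle{\mu\atop k}\right\rangle}{z_\mu}\prod_{i\ge1}X_i^{m_i(\mu)},$$ the sum being over all partitions $\mu$ of $j$ (so $P_{00}=1$). For a partition $\lambda$ put $$d_k(\lambda)=\sum_{(i,j)\in\lambda}\Bigl(j-1-\frac{i-1}{\alpha}\Bigr)^k,\qquad (z)_\lambda=\prod_{(i,j)\in\lambda}\Bigl(z+j-1-\frac{i-1}{\alpha}\Bigr),\qquad F_{jk}(\lambda)=P_{jk}(d_1(\lambda),d_2(\lambda),\dots).$$ **Theorem.** Let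 $x,y$ be independent indeterminates. For every partition $\lambda$, $$\frac{(y-x)_\lambda}{(y)_\lambda}=\sum_{i,j\ge0}(-1)^{i+j}\frac{x^i}{y^{i+j}}\left(\sum_{k=0}^{\min(i,j)}\binom{|\lambda|-j}{i-k}F_{jk}(\lambda)\right).$$ This is an identity of formal series: the rational function on the left is expanded in powers of $1/y$, and the double series on the right converges (unconditionally) to it in the field $\mathbb R(x)((1/y))$ of formal Laurent series in $1/y$, with its $(1/y)$-adic topology. Here $\binom{z}{n}=z(z-1)\cdots(z-n+1)/n!$, also when $z$ is a negative integer. -/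

import Mathlib

namespace JackExpansion

/-- The Ferrers diagram of a partition `μ` of `n`, with rows and columns numbered from `0`:
the row `i` has as many cells as the `i`-th largest part of `μ`. -/
def diagram {n : ℕ} (μ : n.Partition) : YoungDiagram :=
  YoungDiagram.ofRowLens (μ.parts.sort (· ≥ ·)) (Multiset.pairwise_sort μ.parts (· ≥ ·)).sortedGE

/-- The multiplicity `m_i(μ)` of `i` as a part of `μ`. -/
def mult {n : ℕ} (μ : n.Partition) (i : ℕ) : ℕ := μ.parts.count i

/-- `z_μ = ∏_{i ≥ 1} i ^ m_i(μ) * m_i(μ)!`. -/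
def zee {n : ℕ} (μ : n.Partition) : ℕ :=
  ∏ i ∈ Finset.Icc 1 n, i ^ mult μ i * (mult μ i).factorial

/-- The generalized binomial coefficient `⟨μ, r⟩`: the number of ways to choose `r` cells in the
diagram of `μ` with at least one cell chosen in each row. -/
def genBinom {n : ℕ} (μ : n.Partition) (r : ℕ) : ℕ :=
  (((diagram μ).cells.powersetCard r).filter
    fun S => ∀ c ∈ (diagram μ).cells, ∃ s ∈ S, s.1 = c.1).card

/-- The polynomial `P_{jk}(X) = ∑_{|μ| = j} ⟨μ, k⟩ / z_μ * ∏_{i ≥ 1} X_i ^ m_i(μ)` in the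
indeterminates `X_1, X_2, …` (the variable of index `0` does not occur in it). -/
noncomputable def P (j k : ℕ) : MvPolynomial ℕ ℚ :=
  ∑ μ : j.Partition, MvPolynomial.C ((genBinom μ k : ℚ) / (zee μ : ℚ)) *
    ∏ i ∈ Finset.Icc 1 j, MvPolynomial.X i ^ mult μ i

/-- The content `j - 1 - (i - 1) / α` of the cell in row `i` and column `j`, these being numbered
from `1`; in the numbering from `0` of a cell `c` of a diagram it is `c.2 - c.1 / α`. -/
noncomputable def content (α : ℝ) (c : ℕ × ℕ) : ℝ := (c.2 : ℝ) - (c.1 : ℝ) / α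

/-- The power sum `d_k(μ)` of the contents of the cells of `μ`. -/
noncomputable def d (α : ℝ) {n : ℕ} (μ : n.Partition) (k : ℕ) : ℝ :=
  ∑ c ∈ (diagram μ).cells, content α c ^ k

/-- `F_{jk}(μ) = P_{jk}(d_1(μ), d_2(μ), …)`. -/
noncomputable def F (α : ℝ) (j k : ℕ) {n : ℕ} (μ : n.Partition) : ℝ :=
  MvPolynomial.aeval (fun i : ℕ => d α μ i) (P j k)

/-- The field `ℝ(x)((1/y))` of formal Laurent series in `1/y` over the field of rational functions
in `x`, with its `(1/y)`-adic topology. It contains the field `ℝ(x, y)`. -/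
abbrev FormalField : Type := LaurentSeries (RatFunc ℝ)

/-- The indeterminate `x`. -/
noncomputable def x : FormalField := HahnSeries.C RatFunc.X

/-- The indeterminate `y`, the inverse of the variable of the Laurent series. -/
noncomputable def y : FormalField := HahnSeries.single (-1 : ℤ) 1

/-- The inclusion of the real numbers, as constants, into `ℝ(x)((1/y))`. -/
noncomputable def const : ℝ →+* FormalField := HahnSeries.C.comp RatFunc.C

/-- The generalized rising factorial `(z)_μ`, the product over the cells of `μ` of `z` plus the
content of the cell. -/
noncomputable def risingFactorial (α : ℝ) {n : ℕ} (μ : n.Partition) (z : FormalField) :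
    FormalField :=
  ∏ c ∈ (diagram μ).cells, (z + const (content α c))

end JackExpansion

/-! Put `u = -x/y`, `v = -1/y`, and let `c` run over the contents of the cells. The quotient is `∏
(1 + u - c v)/(1 - c v) = (1 + u)^n ∏ (1 - b v)/(1 - c v)` with `b = c/(1 + u)`. By the exponential
formula (`mk_cycleSum_mul_prod`) the coefficient of `v^j` in the last product is the sum of `Y_μ /
z_μ` over partitions `μ` of `j`, where `Y_i = (1 - (1 + u)^(-i)) d_i`. Since `1 - (1 + u)^(-i) = (1
+ u)^(-i) ((1 + u)^i - 1)`, and the product of `(1 + u)^i - 1` over the parts of `μ` generates the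
numbers `⟨μ, k⟩` (`sum_genBinom`), this coefficient is `(1 + u)^(-j) ∑_k F_jk u^k`
(`cycleSum_eq_sum_F`). Expanding `(1 + u)^(n - j)` gives the stated coefficients. All this takes
place in `ℝ⟦u⟧⟦v⟧`; `hasSum_expansion` transports it to Laurent series. -/

namespace JackExpansion

open Finset

/-! ### Multiplicities and `z_μ` when a part is added. -/

/-- The partition obtained from `ν` by adding a part `i`. -/
def addPart {j i : ℕ} (hi : 0 < i) (hij : i ≤ j) (ν : (j - i).Partition) : j.Partition where
  parts := i ::ₘ ν.parts
  parts_pos := by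
    intro a ha
    rcases Multiset.mem_cons.1 ha with rfl | ha
    · exact hi
    · exact ν.parts_pos ha
  parts_sum := by
    rw [Multiset.sum_cons, ν.parts_sum]
    omega

lemma mult_addPart {j i : ℕ} (hi : 0 < i) (hij : i ≤ j) (ν : (j - i).Partition) (a : ℕ) :
    mult (addPart hi hij ν) a = mult ν a + if a = i then 1 else 0 :=
  Multiset.count_cons _ _ _

lemma mult_eq_zero_of_lt {n : ℕ} (μ : n.Partition) {i : ℕ} (h : n < i) : mult μ i = 0 :=
  Multiset.count_eq_zero.2 fun hm => absurd (Nat.Partition.le_of_mem_parts hm) (not_le.2 h)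

lemma prod_mult_extend {R : Type*} [CommMonoid R] {n m : ℕ} (hnm : n ≤ m) (μ : n.Partition)
    (f : ℕ → ℕ → R) (hf : ∀ i, f i 0 = 1) :
    ∏ i ∈ Icc 1 n, f i (mult μ i) = ∏ i ∈ Icc 1 m, f i (mult μ i) := by
  refine prod_subset (Icc_subset_Icc_right hnm) fun _ hi hi' => ?_
  rw [mult_eq_zero_of_lt μ, hf]
  simp only [mem_Icc] at hi hi'
  omega

lemma prod_parts_map {R : Type*} [CommMonoid R] {n : ℕ} (μ : n.Partition) (f : ℕ → R) :
    (μ.parts.map f).prod = ∏ i ∈ Icc 1 n, f i ^ mult μ i := by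
  rw [prod_multiset_map_count]
  refine prod_subset (fun i hi => ?_) fun i _ hi' => ?_
  · rw [Multiset.mem_toFinset] at hi
    exact mem_Icc.2 ⟨μ.parts_pos hi, Nat.Partition.le_of_mem_parts hi⟩
  · rw [Multiset.count_eq_zero.2 (by simpa using hi'), pow_zero]

lemma sum_mult_mul {n : ℕ} (μ : n.Partition) : ∑ i ∈ Icc 1 n, mult μ i * i = n := by
  conv_rhs => rw [← μ.parts_sum, sum_multiset_count]
  symm
  refine sum_subset (fun i hi => ?_) fun i _ hi' => ?_
  · rw [Multiset.mem_toFinset] at hi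
    exact mem_Icc.2 ⟨μ.parts_pos hi, Nat.Partition.le_of_mem_parts hi⟩
  · rw [Multiset.count_eq_zero.2 (by simpa using hi'), zero_smul]

lemma zee_pos {n : ℕ} (μ : n.Partition) : 0 < zee μ :=
  prod_pos fun _ hi => Nat.mul_pos (Nat.pow_pos (mem_Icc.1 hi).1) (Nat.factorial_pos _)

lemma zee_addPart {j i : ℕ} (hi : 0 < i) (hij : i ≤ j) (ν : (j - i).Partition) :
    zee (addPart hi hij ν) = i * (mult ν i + 1) * zee ν := by
  unfold zee
  rw [prod_mult_extend (Nat.sub_le j i) ν (fun i m => i ^ m * m.factorial) (by simp)]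
  have h : ∀ a ∈ Icc 1 j, a ^ mult (addPart hi hij ν) a * (mult (addPart hi hij ν) a).factorial =
      (if a = i then i * (mult ν i + 1) else 1) * (a ^ mult ν a * (mult ν a).factorial) := by
    intro a _
    rw [mult_addPart]
    split_ifs with h
    · subst h
      rw [pow_succ, Nat.factorial_succ]
      ring
    · simp
  rw [prod_congr rfl h, prod_mul_distrib, prod_ite_eq', if_pos (mem_Icc.2 ⟨hi, hij⟩)]

/-! ### Recursion for the cycle sums. -/

section CycleIndex

variable {R : Type*} [CommRing R] [Algebra ℝ R]

/-- The term `Y_μ / z_μ` of the cycle index sum. -/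
noncomputable def cycleTerm (Y : ℕ → R) {j : ℕ} (μ : j.Partition) : R :=
  algebraMap ℝ R (zee μ : ℝ)⁻¹ * ∏ i ∈ Icc 1 j, Y i ^ mult μ i

/-- The sum of `Y_μ / z_μ` over the partitions `μ` of `j`. -/
noncomputable def cycleSum (Y : ℕ → R) (j : ℕ) : R := ∑ μ : j.Partition, cycleTerm Y μ

lemma cycleTerm_addPart (Y : ℕ → R) {j i : ℕ} (hi : 0 < i) (hij : i ≤ j)
    (ν : (j - i).Partition) :
    ((mult (addPart hi hij ν) i * i : ℕ) : R) * cycleTerm Y (addPart hi hij ν) =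
      Y i * cycleTerm Y ν := by
  unfold cycleTerm
  rw [prod_mult_extend (Nat.sub_le j i) ν (fun i m => Y i ^ m) (by simp)]
  have h : ∀ a ∈ Icc 1 j, Y a ^ mult (addPart hi hij ν) a =
      (if a = i then Y i else 1) * Y a ^ mult ν a := by
    intro a _
    rw [mult_addPart]
    split_ifs with h
    · subst h
      rw [pow_succ, mul_comm]
    · simp
  rw [prod_congr rfl h, prod_mul_distrib, prod_ite_eq', if_pos (mem_Icc.2 ⟨hi, hij⟩),
    zee_addPart, mult_addPart, if_pos rfl]
  have hz : (zee ν : ℝ) ≠ 0 := by exact_mod_cast (zee_pos ν).ne'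
  have hi' : (i : ℝ) ≠ 0 := by exact_mod_cast hi.ne'
  have hm : (mult ν i : ℝ) + 1 ≠ 0 := by positivity
  have h2 : (((mult ν i + 1) * i : ℕ) : R) *
      algebraMap ℝ R ((i * (mult ν i + 1) * zee ν : ℕ) : ℝ)⁻¹ = algebraMap ℝ R (zee ν : ℝ)⁻¹ := by
    rw [← map_natCast (algebraMap ℝ R), ← map_mul]
    congr 1
    push_cast
    field_simp
  rw [← h2]
  ring

/-- Deleting one part `i` matches the partitions of `j` containing `i` with all partitions of `j -
i`; the other partitions have weight zero. The weight `i * m_i` cancels the factor by which `z`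
grows. -/
lemma sum_mult_mul_cycleTerm (Y : ℕ → R) {j i : ℕ} (hi : 0 < i) (hij : i ≤ j) :
    ∑ μ : j.Partition, ((mult μ i * i : ℕ) : R) * cycleTerm Y μ = Y i * cycleSum Y (j - i) := by
  rw [cycleSum, mul_sum]
  symm
  refine sum_of_injOn (addPart hi hij) ?_ (fun _ _ => mem_coe.2 (mem_univ _)) ?_
    fun ν _ => (cycleTerm_addPart Y hi hij ν).symm
  · intro ν _ ν' _ h
    have := congrArg Nat.Partition.parts h
    exact Nat.Partition.ext ((Multiset.cons_inj_right i).1 this)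
  · intro μ _ hμ
    have : mult μ i = 0 := by
      by_contra hm
      have hmem : i ∈ μ.parts := by
        by_contra h
        exact hm (Multiset.count_eq_zero.2 h)
      refine hμ ⟨⟨μ.parts.erase i, fun ha => μ.parts_pos (Multiset.mem_of_mem_erase ha), ?_⟩,
        mem_coe.2 (mem_univ _), Nat.Partition.ext (Multiset.cons_erase hmem)⟩
      have h1 := congrArg Multiset.sum (Multiset.cons_erase hmem)
      rw [Multiset.sum_cons, μ.parts_sum] at h1
      omega
    rw [this]
    simp

/-- Newton's recursion, from writing `j` as `∑ i * m_i(μ)`. It encodes the logarithmic derivative of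
the generating series. -/
lemma natCast_mul_cycleSum (Y : ℕ → R) (j : ℕ) :
    (j : R) * cycleSum Y j = ∑ i ∈ Icc 1 j, Y i * cycleSum Y (j - i) := by
  have h : ∀ μ : j.Partition, (j : R) * cycleTerm Y μ =
      ∑ i ∈ Icc 1 j, ((mult μ i * i : ℕ) : R) * cycleTerm Y μ := by
    intro μ
    rw [← sum_mul, ← Nat.cast_sum, sum_mult_mul]
  rw [cycleSum, mul_sum, sum_congr rfl fun μ _ => h μ, sum_comm]
  exact sum_congr rfl fun i hi => sum_mult_mul_cycleTerm Y (mem_Icc.1 hi).1 (mem_Icc.1 hi).2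

lemma cycleSum_zero (Y : ℕ → R) : cycleSum Y 0 = 1 := by
  simp [cycleSum, cycleTerm, zee]

end CycleIndex

/-! ### Generating function of the generalized binomial coefficients. -/

section Diagram

variable {R : Type*} [CommRing R]

lemma mem_cells_diagram {n : ℕ} (μ : n.Partition) (c : ℕ × ℕ) :
    c ∈ (diagram μ).cells ↔ ∃ h : c.1 < (μ.parts.sort (· ≥ ·)).length,
      c.2 < (μ.parts.sort (· ≥ ·))[c.1] :=
  YoungDiagram.mem_cellsOfRowLens

lemma sum_pow_card_nonempty (q : R) (m : ℕ) :
    ∑ t ∈ (range m).powerset.erase ∅, q ^ #t = (1 + q) ^ m - 1 := by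
  rw [sum_erase_eq_sub (by simp), sum_powerset_apply_card (fun k => q ^ k), card_range, add_comm 1 q,
    add_pow]
  simp [nsmul_eq_mul, mul_comm]

/-- The choices in different rows are independent, and the nonempty subsets of a row of `m` cells
have generating function `(1 + q)^m - 1`. -/
lemma sum_rowTransversal (q : R) (C : Finset (ℕ × ℕ)) (w : List ℕ)
    (hw : ∀ a ∈ w, 0 < a)
    (hC : ∀ c, c ∈ C ↔ ∃ h : c.1 < w.length, c.2 < w[c.1]) :
    ∑ S ∈ C.powerset with ∀ c ∈ C, ∃ s ∈ S, s.1 = c.1, q ^ #S =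
      (w.map fun m => (1 + q) ^ m - 1).prod := by
  have h1 : (w.map fun m => (1 + q) ^ m - 1).prod =
      ∏ i : Fin w.length, ((1 + q) ^ w[i] - 1) := by
    rw [← List.prod_ofFn]
    congr 1
    exact List.ext_getElem (by simp) (by simp)
  rw [h1, prod_congr rfl fun i _ => (sum_pow_card_nonempty q _).symm, prod_univ_sum]
  refine sum_bij' (fun S _ i => (S.filter fun c => c.1 = (i : ℕ)).image Prod.snd)
    (fun p _ => C.filter fun c => ∃ h : c.1 < w.length, c.2 ∈ p ⟨c.1, h⟩) ?_ ?_ ?_ ?_ ?_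
  · intro S hS
    simp only [mem_filter, mem_powerset] at hS
    simp only [Fintype.mem_piFinset, mem_erase, mem_powerset]
    intro i
    -- The condition on `S` is indexed by cells, so positivity of the row length is what makes it
    -- apply to row `i`.
    have hi : ((i : ℕ), 0) ∈ C := (hC _).2 ⟨i.2, hw _ (List.getElem_mem _)⟩
    obtain ⟨s, hs, hs1⟩ := hS.2 _ hi
    refine ⟨ne_empty_of_mem (mem_image_of_mem _ (mem_filter.2 ⟨hs, hs1⟩)), ?_⟩
    intro b hb
    simp only [mem_image, mem_filter] at hb
    obtain ⟨a, ⟨ha, hai⟩, rfl⟩ := hb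
    obtain ⟨h, h'⟩ := (hC a).1 (hS.1 ha)
    simp only [hai] at h'
    exact mem_range.2 h'
  · intro p hp
    simp only [Fintype.mem_piFinset, mem_erase, mem_powerset] at hp
    simp only [mem_filter, mem_powerset, filter_subset, true_and]
    intro c hc
    obtain ⟨h, h'⟩ := (hC c).1 hc
    obtain ⟨b, hb⟩ := nonempty_iff_ne_empty.2 (hp ⟨c.1, h⟩).1
    exact ⟨(c.1, b), ⟨(hC _).2 ⟨h, mem_range.1 ((hp ⟨c.1, h⟩).2 hb)⟩, h, hb⟩, rfl⟩
  · intro S hS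
    simp only [mem_filter, mem_powerset] at hS
    ext ⟨a, b⟩
    simp only [mem_filter, mem_image, Prod.exists, exists_eq_right]
    constructor
    · rintro ⟨_, _, h⟩
      exact h
    · intro h
      obtain ⟨h', _⟩ := (hC _).1 (hS.1 h)
      exact ⟨hS.1 h, h', h⟩
  · intro p hp
    simp only [Fintype.mem_piFinset, mem_erase, mem_powerset] at hp
    ext i b
    simp only [mem_filter, mem_image, Prod.exists, exists_eq_right]
    constructor
    · rintro ⟨_, _, hb⟩
      exact hb
    · intro hb
      exact ⟨(hC _).2 ⟨i.2, mem_range.1 ((hp i).2 hb)⟩, i.2, hb⟩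
  · intro S hS
    simp only [mem_filter, mem_powerset] at hS
    rw [prod_pow_eq_pow_sum]
    congr 1
    have hmap : ∀ c ∈ S, c.1 ∈ range w.length := fun c hc =>
      mem_range.2 ((hC c).1 (hS.1 hc)).1
    rw [card_eq_sum_card_fiberwise hmap, sum_range]
    refine sum_congr rfl fun i _ => ?_
    rw [card_image_of_injOn]
    rintro ⟨a, b⟩ h ⟨a', b'⟩ h' hb
    simp only [coe_filter, Set.mem_ofPred_eq] at h h' hb
    exact Prod.ext (h.2.trans h'.2.symm) hb

lemma card_diagram {n : ℕ} (μ : n.Partition) : #(diagram μ).cells = n := by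
  have hmap : ∀ c ∈ (diagram μ).cells, c.1 ∈ range (μ.parts.sort (· ≥ ·)).length := fun c hc =>
    mem_range.2 ((mem_cells_diagram μ c).1 hc).1
  rw [card_eq_sum_card_fiberwise hmap, sum_range]
  have h : ∀ i : Fin (μ.parts.sort (· ≥ ·)).length,
      #{c ∈ (diagram μ).cells | c.1 = (i : ℕ)} = (μ.parts.sort (· ≥ ·))[i] := by
    intro i
    have : {c ∈ (diagram μ).cells | c.1 = (i : ℕ)} =
        ({(i : ℕ)} : Finset ℕ) ×ˢ range (μ.parts.sort (· ≥ ·))[i] := by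
      ext ⟨a, b⟩
      simp only [mem_filter, mem_cells_diagram, mem_product, mem_singleton, mem_range]
      constructor
      · rintro ⟨⟨_, h⟩, rfl : a = i⟩
        exact ⟨rfl, h⟩
      · rintro ⟨rfl, h⟩
        exact ⟨⟨i.2, h⟩, rfl⟩
    rw [this, card_product, card_singleton, card_range, one_mul]
  rw [sum_congr rfl fun i _ => h i, ← List.sum_ofFn]
  have h2 : List.ofFn (fun i : Fin (μ.parts.sort (· ≥ ·)).length => (μ.parts.sort (· ≥ ·))[i]) =
      μ.parts.sort (· ≥ ·) := List.ext_getElem (by simp) (by simp)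
  rw [h2, ← Multiset.sum_coe, Multiset.sort_eq, μ.parts_sum]

lemma sum_genBinom (q : R) {n : ℕ} (μ : n.Partition) :
    ∑ k ∈ range (n + 1), (genBinom μ k : R) * q ^ k =
      ∏ i ∈ Icc 1 n, ((1 + q) ^ i - 1) ^ mult μ i := by
  rw [← prod_parts_map μ fun m => (1 + q) ^ m - 1]
  have h1 : (μ.parts.map fun m => (1 + q) ^ m - 1).prod =
      ((μ.parts.sort (· ≥ ·)).map fun m => (1 + q) ^ m - 1).prod := by
    rw [← Multiset.prod_coe, ← Multiset.map_coe, Multiset.sort_eq]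
  rw [h1, ← sum_rowTransversal q (diagram μ).cells _
    (fun a ha => μ.parts_pos (by simpa using ha)) (mem_cells_diagram μ),
    sum_filter, sum_powerset, card_diagram]
  refine sum_congr rfl fun k _ => ?_
  rw [← sum_filter, genBinom, ← nsmul_eq_mul, ← sum_const]
  refine sum_congr rfl fun S hS => ?_
  rw [(mem_powersetCard.1 (mem_filter.1 hS).1).2]

end Diagram

end JackExpansion

namespace JackExpansion

open Finset

/-! ### Exponential formula by logarithmic derivatives. -/

section LogDerivative

open PowerSeries

variable {R : Type*} [CommRing R]

lemma coeff_X_mul_derivative (f : R⟦X⟧) (n : ℕ) :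
    coeff n (X * derivative R f) = n * coeff n f := by
  cases n with
  | zero => simp
  | succ n =>
    rw [coeff_succ_X_mul, coeff_derivative]
    push_cast
    ring

/-- As `L` has no constant term, the equation expresses `n` times the `n`-th coefficient through
earlier ones, and `n > 0` is invertible in an `ℝ`-algebra. -/
lemma eq_of_X_mul_derivative_eq [Algebra ℝ R] {f g L : R⟦X⟧} (hL : coeff 0 L = 0)
    (hf : X * derivative R f = L * f) (hg : X * derivative R g = L * g)
    (h0 : coeff 0 f = coeff 0 g) : f = g := by
  ext n
  induction n using Nat.strong_induction_on with
  | _ n ih =>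
    rcases Nat.eq_zero_or_pos n with rfl | hn
    · exact h0
    have hu : IsUnit ((n : ℕ) : R) := by
      rw [← map_natCast (algebraMap ℝ R)]
      exact (IsUnit.mk0 _ (by exact_mod_cast hn.ne')).map _
    refine hu.mul_left_cancel ?_
    rw [← coeff_X_mul_derivative, ← coeff_X_mul_derivative, hf, hg, coeff_mul, coeff_mul]
    refine sum_congr rfl fun p hp => ?_
    rw [HasAntidiagonal.mem_antidiagonal] at hp
    rcases Nat.eq_zero_or_pos p.1 with h | h
    · rw [h, hL, zero_mul, zero_mul]
    · rw [ih p.2 (by omega)]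

/-- The logarithmic derivative of `1 - c X`, multiplied by `X`. -/
noncomputable def logDer (c : R) : R⟦X⟧ := -(X * (C c * PowerSeries.mk fun i => c ^ i))

lemma mk_pow_mul (c : R) : (PowerSeries.mk fun i => c ^ i) * (1 - C c * X) = 1 := by
  ext n
  rw [mul_sub, mul_one, ← mul_assoc, map_sub]
  cases n with
  | zero => simp
  | succ n =>
    rw [coeff_succ_mul_X, mul_comm, coeff_C_mul, coeff_mk, coeff_mk, coeff_one]
    simp [pow_succ']

lemma X_mul_derivative_factor (c : R) :
    X * derivative R (1 - C c * X) = logDer c * (1 - C c * X) := by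
  have h : derivative R (1 - C c * X : R⟦X⟧) = - C c := by
    simp [Derivation.leibniz]
  rw [h, logDer]
  linear_combination (X * C c : R⟦X⟧) * mk_pow_mul c

lemma coeff_zero_logDer (c : R) : coeff 0 (logDer c) = 0 := by
  simp [logDer]

lemma coeff_logDer (c : R) {i : ℕ} (hi : 0 < i) : coeff i (logDer c) = -c ^ i := by
  obtain ⟨k, rfl⟩ := Nat.exists_eq_succ_of_ne_zero hi.ne'
  rw [logDer, map_neg, coeff_succ_X_mul, coeff_C_mul, coeff_mk, pow_succ']

lemma X_mul_derivative_prod {ι : Type*} (s : Finset ι) (c : ι → R) :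
    X * derivative R (∏ k ∈ s, (1 - C (c k) * X)) =
      (∑ k ∈ s, logDer (c k)) * ∏ k ∈ s, (1 - C (c k) * X) := by
  classical
  induction s using Finset.induction_on with
  | empty => simp
  | insert a s ha ih =>
    rw [prod_insert ha, sum_insert ha, Derivation.leibniz, smul_eq_mul, smul_eq_mul]
    linear_combination (1 - C (c a) * X : R⟦X⟧) * ih +
      (∏ k ∈ s, (1 - C (c k) * X)) * X_mul_derivative_factor (c a)

/-- The exponential formula for the cycle sums of a difference of power sums. -/
lemma mk_cycleSum_mul_prod [Algebra ℝ R] {ι : Type*} (s : Finset ι) (b c : ι → R) (Y : ℕ → R)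
    (hY : ∀ i, 0 < i → Y i = ∑ k ∈ s, (c k ^ i - b k ^ i)) :
    PowerSeries.mk (cycleSum Y) * ∏ k ∈ s, (1 - C (c k) * X) = ∏ k ∈ s, (1 - C (b k) * X) := by
  -- The bracket is `∑ Y_i X^i`, so this is Newton's recursion read coefficientwise.
  have hA : X * derivative R (PowerSeries.mk (cycleSum Y)) =
      (∑ k ∈ s, logDer (b k) - ∑ k ∈ s, logDer (c k)) * PowerSeries.mk (cycleSum Y) := by
    ext j
    rw [coeff_X_mul_derivative, coeff_mk, natCast_mul_cycleSum, coeff_mul,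
      Finset.Nat.sum_antidiagonal_eq_sum_range_succ
        (fun a d => coeff a (∑ k ∈ s, logDer (b k) - ∑ k ∈ s, logDer (c k)) *
          coeff d (PowerSeries.mk (cycleSum Y))), sum_range_succ']
    rw [map_sub, map_sum, map_sum]
    simp only [coeff_zero_logDer, sum_const_zero, sub_zero, zero_mul, add_zero]
    symm
    refine sum_bij' (fun i _ => i + 1) (fun i _ => i - 1)
      (fun i hi => by simp only [mem_range, mem_Icc] at *; omega)
      (fun i hi => by simp only [mem_range, mem_Icc] at *; omega) (fun i _ => rfl)
      (fun i hi => by simp only [mem_Icc] at hi; omega) fun i _ => ?_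
    rw [coeff_mk, hY _ i.succ_pos, map_sub, map_sum, map_sum, sum_sub_distrib]
    simp only [coeff_logDer _ i.succ_pos, sum_neg_distrib]
    ring
  refine eq_of_X_mul_derivative_eq (L := ∑ k ∈ s, logDer (b k)) ?_ ?_
    (X_mul_derivative_prod s b) ?_
  · simp [coeff_zero_logDer]
  · rw [Derivation.leibniz, smul_eq_mul, smul_eq_mul]
    linear_combination (PowerSeries.mk (cycleSum Y)) * X_mul_derivative_prod s c +
      (∏ k ∈ s, (1 - C (c k) * X)) * hA
  · simp [cycleSum_zero, map_prod]

end LogDerivative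

/-! ### The identity in two formal indeterminates. -/

section Expansion

open PowerSeries

lemma F_eq (α : ℝ) (j k : ℕ) {n : ℕ} (lam : n.Partition) :
    F α j k lam = ∑ μ : j.Partition, (genBinom μ k : ℝ) / (zee μ : ℝ) *
      ∏ i ∈ Icc 1 j, d α lam i ^ mult μ i := by
  simp [F, P, map_sum, map_prod]

/-- The inverse of `1 + X`. -/
noncomputable def invOneAddX : ℝ⟦X⟧ := binomialSeries ℝ (-1 : ℤ)

lemma one_add_X_mul_inv : (1 + X) * invOneAddX = 1 := by
  have h := binomialSeries_add (A := ℝ) ((1 : ℕ) : ℤ) (-1)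
  rw [binomialSeries_nat, pow_one] at h
  rw [invOneAddX, ← h]
  simp

/-- The exponent may be negative; this is where binomial coefficients with negative upper entry come
from. -/
lemma binomialSeries_sub (n j : ℕ) :
    binomialSeries ℝ ((n : ℤ) - (j : ℤ)) = (1 + X) ^ n * invOneAddX ^ j := by
  have h : binomialSeries ℝ (-(j : ℤ)) = invOneAddX ^ j := by
    induction j with
    | zero => simp
    | succ j ih =>
      rw [pow_succ, ← ih, invOneAddX, ← binomialSeries_add]
      congr 1
      push_cast
      ring
  rw [sub_eq_add_neg, binomialSeries_add, binomialSeries_nat, h]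

lemma cycleSum_eq_sum_F (α : ℝ) {n : ℕ} (lam : n.Partition) (j : ℕ) :
    cycleSum (fun i => (1 - invOneAddX ^ i) * C (d α lam i)) j =
      invOneAddX ^ j * ∑ k ∈ range (j + 1), C (F α j k lam) * X ^ k := by
  have hterm : ∀ μ : j.Partition,
      cycleTerm (fun i => (1 - invOneAddX ^ i) * C (d α lam i)) μ =
        invOneAddX ^ j * ∑ k ∈ range (j + 1), C ((genBinom μ k : ℝ) / (zee μ : ℝ) *
          ∏ i ∈ Icc 1 j, d α lam i ^ mult μ i) * X ^ k := by
    intro μ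
    have hfac : ∀ i, (1 - invOneAddX ^ i) * C (d α lam i) =
        invOneAddX ^ i * (((1 + X) ^ i - 1) * C (d α lam i)) := by
      intro i
      have : (1 + X) ^ i * invOneAddX ^ i = 1 := by
        rw [← mul_pow, one_add_X_mul_inv, one_pow]
      linear_combination -C (d α lam i) * this
    -- The exponent depends only on the weight of `μ`, so this factor leaves the sum over `μ`.
    have hW : ∏ i ∈ Icc 1 j, (invOneAddX ^ i) ^ mult μ i = invOneAddX ^ j := by
      conv_rhs => rw [← sum_mult_mul μ, ← prod_pow_eq_pow_sum]
      refine prod_congr rfl fun i _ => ?_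
      rw [← pow_mul, mul_comm]
    rw [cycleTerm]
    simp only [hfac, mul_pow, prod_mul_distrib]
    rw [hW, ← sum_genBinom, sum_mul, mul_left_comm, mul_sum]
    congr 1
    refine sum_congr rfl fun k _ => ?_
    rw [PowerSeries.algebraMap_apply, Algebra.algebraMap_self, RingHom.id_apply, map_mul,
      div_eq_mul_inv, map_mul, map_prod, map_natCast]
    simp only [map_pow]
    ring
  rw [cycleSum, sum_congr rfl fun μ _ => hterm μ, ← mul_sum, sum_comm]
  congr 1
  refine sum_congr rfl fun k _ => ?_
  rw [F_eq, map_sum, sum_mul]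

/-- The double series of the theorem, as a series in two indeterminates `X_1 = -x/y` (inner) and
`X_2 = -1/y` (outer). -/
noncomputable def expansion (α : ℝ) {n : ℕ} (lam : n.Partition) : (ℝ⟦X⟧)⟦X⟧ :=
  PowerSeries.mk fun j => PowerSeries.mk fun i => ∑ k ∈ range (min i j + 1),
    ((Ring.choose ((n : ℤ) - (j : ℤ)) (i - k) : ℤ) : ℝ) * F α j k lam

lemma coeff_expansion (α : ℝ) {n : ℕ} (lam : n.Partition) (j : ℕ) :
    coeff j (expansion α lam) =
      (1 + X) ^ n * cycleSum (fun i => (1 - invOneAddX ^ i) * C (d α lam i)) j := by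
  rw [cycleSum_eq_sum_F, ← mul_assoc, ← binomialSeries_sub, expansion, coeff_mk, mul_sum]
  ext i
  rw [coeff_mk, map_sum]
  -- The shift by `X ^ k` forces `k ≤ i`; with `k ≤ j` this yields the bound `min i j`.
  have h : ∀ k, coeff i (binomialSeries ℝ ((n : ℤ) - (j : ℤ)) * (C (F α j k lam) * X ^ k)) =
      if k ≤ i then ((Ring.choose ((n : ℤ) - (j : ℤ)) (i - k) : ℤ) : ℝ) * F α j k lam else 0 := by
    intro k
    rw [← mul_assoc, coeff_mul_X_pow', coeff_mul_C, binomialSeries_coeff, zsmul_one]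
  rw [sum_congr rfl fun k _ => h k, ← sum_filter]
  refine sum_congr ?_ fun _ _ => rfl
  ext k
  simp only [mem_range, mem_filter]
  omega

lemma expansion_mul_prod (α : ℝ) {n : ℕ} (lam : n.Partition) :
    expansion α lam * ∏ c ∈ (diagram lam).cells, (1 - C (C (content α c)) * X) =
      ∏ c ∈ (diagram lam).cells, (C (1 + X) - C (C (content α c)) * X) := by
  have h1 : expansion α lam = C ((1 + X) ^ n) *
      PowerSeries.mk (cycleSum fun i => (1 - invOneAddX ^ i) * C (d α lam i)) := by
    ext1 j
    rw [coeff_expansion, coeff_C_mul, coeff_mk]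
  rw [h1, mul_assoc, mk_cycleSum_mul_prod _ (fun c => C (content α c) * invOneAddX),
    map_pow]
  · have h3 : (C (1 + X) ^ n : (ℝ⟦X⟧)⟦X⟧) = ∏ _c ∈ (diagram lam).cells, C (1 + X) := by
      rw [prod_const, card_diagram]
    rw [h3, ← prod_mul_distrib]
    refine prod_congr rfl fun c _ => ?_
    have h2 : (C (1 + X) * C invOneAddX : (ℝ⟦X⟧)⟦X⟧) = 1 := by
      rw [← map_mul, one_add_X_mul_inv, map_one]
    rw [map_mul]
    linear_combination -(C (C (content α c)) * X) * h2
  · intro i _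
    simp only [mul_pow, ← map_pow]
    rw [d, map_sum, mul_sum]
    exact sum_congr rfl fun c _ => by ring

end Expansion

end JackExpansion

namespace JackExpansion

open Finset

/-! ### Substitution into Laurent series, and convergence. -/

section Evaluation

open PowerSeries WithZero

lemma y_ne_zero : y ≠ 0 := HahnSeries.single_ne_zero one_ne_zero

lemma inv_y_pow (m : ℕ) : (y ^ m)⁻¹ = HahnSeries.single (m : ℤ) 1 := by
  refine inv_eq_of_mul_eq_one_left ?_
  rw [y, HahnSeries.single_pow, HahnSeries.single_mul_single]
  simp

/-- The term of index `p` of the series `G`, where the inner indeterminate is replaced by `-x/y`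
and the outer one by `-1/y`. -/
noncomputable def substTerm (G : (ℝ⟦X⟧)⟦X⟧) (p : ℕ × ℕ) : FormalField :=
  (-x / y) ^ p.1 * (-1 / y) ^ p.2 * const (coeff p.1 (coeff p.2 G))

lemma substTerm_eq (G : (ℝ⟦X⟧)⟦X⟧) (p : ℕ × ℕ) :
    substTerm G p = (-1 : FormalField) ^ (p.1 + p.2) * (x ^ p.1 / y ^ (p.1 + p.2)) *
      const (coeff p.1 (coeff p.2 G)) := by
  have := y_ne_zero
  rw [substTerm, div_pow, div_pow, neg_pow x, pow_add, pow_add]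
  field_simp

/-- Each term is a single monomial of degree `p.1 + p.2` in `1/y`, with coefficient in `ℝ(x)`. -/
lemma valuation_substTerm_le (G : (ℝ⟦X⟧)⟦X⟧) (p : ℕ × ℕ) :
    Valued.v (substTerm G p) ≤ exp (-((p.1 + p.2 : ℕ) : ℤ)) := by
  rw [LaurentSeries.valuation_le_iff_coeff_lt_eq_zero]
  intro m hm
  have h : substTerm G p = HahnSeries.single ((p.1 + p.2 : ℕ) : ℤ) 1 *
      HahnSeries.C ((-1) ^ (p.1 + p.2) * RatFunc.X ^ p.1 *
        RatFunc.C (coeff p.1 (coeff p.2 G))) := by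
    rw [substTerm_eq, ← inv_y_pow, x, const]
    simp only [map_mul, map_pow, map_neg, map_one, RingHom.comp_apply]
    ring
  rw [h, HahnSeries.C_apply, HahnSeries.single_mul_single, add_zero,
    HahnSeries.coeff_single_of_ne hm.ne]

/-- The valuation balls are open subgroups. Hence, the field being complete, terms tending to zero
already give unconditional summability. -/
instance : NonarchimedeanAddGroup FormalField where
  is_nonarchimedean U hU := by
    obtain ⟨γ, hγ⟩ := Valued.mem_nhds_zero.1 hU
    let V : AddSubgroup FormalField :=
      ((Valued.v : Valuation FormalField ℤᵐ⁰).restrict).ltAddSubgroup γ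
    have hV : (V : Set FormalField) ∈ nhds 0 := Valued.mem_nhds_zero.2 ⟨γ, fun _ h => h⟩
    exact ⟨⟨V, V.isOpen_of_mem_nhds hV⟩, hγ⟩

lemma summable_substTerm (G : (ℝ⟦X⟧)⟦X⟧) : Summable (substTerm G) := by
  refine NonarchimedeanAddGroup.summable_of_tendsto_cofinite_zero ?_
  rw [(Valued.hasBasis_nhds_zero FormalField ℤᵐ⁰).tendsto_right_iff]
  intro γ _
  obtain ⟨N, hN⟩ : ∃ N : ℕ,
      exp (-(N : ℤ)) < MonoidWithZeroHom.ValueGroup₀.embedding γ.1 := by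
    have hne : MonoidWithZeroHom.ValueGroup₀.embedding γ.1 ≠ 0 := by simp
    refine ⟨(1 - log (MonoidWithZeroHom.ValueGroup₀.embedding γ.1)).toNat, ?_⟩
    rw [← lt_log_iff_exp_lt hne]
    omega
  simp only [Valuation.restrict_lt_iff_lt_embedding]
  rw [Filter.eventually_cofinite]
  -- Outside this square `p.1 + p.2 ≥ N`, so the term is already small.
  refine ((range N) ×ˢ (range N)).finite_toSet.subset fun p hp => ?_
  by_contra hp'
  refine hp (lt_of_le_of_lt ((valuation_substTerm_le G p).trans ?_) hN)
  rw [exp_le_exp]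
  simp only [coe_product, Set.mem_prod, mem_coe, mem_range] at hp'
  omega

lemma hasSum_substTerm_one : HasSum (substTerm 1) 1 := by
  have h := hasSum_single (f := substTerm 1) (0, 0) fun p hp => by
    have : coeff p.1 (coeff p.2 (1 : (ℝ⟦X⟧)⟦X⟧)) = 0 := by
      rw [coeff_one]
      split_ifs with h
      · rw [coeff_one, if_neg]
        exact fun h' => hp (Prod.ext h' h)
      · simp
    rw [substTerm, this, map_zero, mul_zero]
  simpa [substTerm] using h

/-- Sums, real scalars and the two indeterminates suffice: the series is only ever multiplied by
polynomials, so no Cauchy product of infinite families is needed. -/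
lemma hasSum_substTerm_add {G H : (ℝ⟦X⟧)⟦X⟧} {s t : FormalField} (hG : HasSum (substTerm G) s)
    (hH : HasSum (substTerm H) t) : HasSum (substTerm (G + H)) (s + t) := by
  refine Eq.mp (congrArg (HasSum · _) (funext fun p => ?_)) (hG.add hH)
  simp only [substTerm, map_add]
  ring

lemma hasSum_substTerm_C {G : (ℝ⟦X⟧)⟦X⟧} {s : FormalField} (hG : HasSum (substTerm G) s) (r : ℝ) :
    HasSum (substTerm (G * C (C r))) (s * const r) := by
  refine Eq.mp (congrArg (HasSum · _) (funext fun p => ?_)) (hG.mul_right (const r))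
  rw [substTerm, substTerm, coeff_mul_C, coeff_mul_C, map_mul]
  ring

lemma hasSum_substTerm_X {G : (ℝ⟦X⟧)⟦X⟧} {s : FormalField} (hG : HasSum (substTerm G) s) :
    HasSum (substTerm (G * X)) (s * (-1 / y)) := by
  have hinj : Function.Injective fun p : ℕ × ℕ => (p.1, p.2 + 1) := by
    rintro ⟨a, b⟩ ⟨a', b'⟩ h
    simpa using h
  -- Multiplication by the indeterminate shifts the index; the indices missed have zero terms.
  rw [← hinj.hasSum_iff]
  · refine Eq.mp (congrArg (HasSum · _) (funext fun p => ?_)) (hG.mul_right (-1 / y))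
    rw [Function.comp_apply, substTerm, substTerm, coeff_succ_mul_X, pow_succ]
    ring
  · rintro ⟨a, b⟩ h
    cases b with
    | zero => simp [substTerm]
    | succ b => exact absurd ⟨(a, b), rfl⟩ h

lemma hasSum_substTerm_C_X {G : (ℝ⟦X⟧)⟦X⟧} {s : FormalField} (hG : HasSum (substTerm G) s) :
    HasSum (substTerm (G * C X)) (s * (-x / y)) := by
  have hinj : Function.Injective fun p : ℕ × ℕ => (p.1 + 1, p.2) := by
    rintro ⟨a, b⟩ ⟨a', b'⟩ h
    simpa using h
  rw [← hinj.hasSum_iff]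
  · refine Eq.mp (congrArg (HasSum · _) (funext fun p => ?_)) (hG.mul_right (-x / y))
    rw [Function.comp_apply, substTerm, substTerm, coeff_mul_C, coeff_succ_mul_X, pow_succ]
    ring
  · rintro ⟨a, b⟩ h
    cases a with
    | zero => simp [substTerm, coeff_mul_C]
    | succ a => exact absurd ⟨(a, b), rfl⟩ h

lemma hasSum_substTerm_mul_prod {G : (ℝ⟦X⟧)⟦X⟧} {s : FormalField} (hG : HasSum (substTerm G) s)
    {ι : Type*} (S : Finset ι) (c : ι → ℝ) :
    HasSum (substTerm (G * ∏ k ∈ S, (1 - C (C (c k)) * X)))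
      (s * ∏ k ∈ S, (1 + const (c k) / y)) := by
  classical
  induction S using Finset.induction_on with
  | empty => simpa using hG
  | insert a S ha ih =>
    rw [prod_insert ha, prod_insert ha]
    convert hasSum_substTerm_add ih (hasSum_substTerm_X (hasSum_substTerm_C ih (-c a))) using 2
    · simp only [map_neg]
      ring
    · rw [map_neg]
      ring

lemma hasSum_substTerm_prod {ι : Type*} (S : Finset ι) (c : ι → ℝ) :
    HasSum (substTerm (∏ k ∈ S, (C (1 + X) - C (C (c k)) * X)))
      (∏ k ∈ S, (1 - x / y + const (c k) / y)) := by
  classical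
  induction S using Finset.induction_on with
  | empty => simpa using hasSum_substTerm_one
  | insert a S ha ih =>
    rw [prod_insert ha, prod_insert ha]
    convert hasSum_substTerm_add (hasSum_substTerm_add ih (hasSum_substTerm_C_X ih))
      (hasSum_substTerm_X (hasSum_substTerm_C ih (-c a))) using 2
    · simp only [map_neg, map_add, map_one]
      ring
    · rw [map_neg]
      ring

lemma y_add_const_ne_zero (r : ℝ) : y + const r ≠ 0 := by
  intro h
  have h1 := congrArg (fun f : FormalField => f.coeff (-1)) h
  simp [y, const, HahnSeries.C_apply] at h1

lemma hasSum_expansion (α : ℝ) {n : ℕ} (lam : n.Partition) :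
    HasSum (substTerm (expansion α lam))
      (risingFactorial α lam (y - x) / risingFactorial α lam y) := by
  obtain ⟨s, hs⟩ := summable_substTerm (expansion α lam)
  have h1 := hasSum_substTerm_mul_prod hs (diagram lam).cells (content α)
  rw [expansion_mul_prod] at h1
  -- Uniqueness of limits: the unknown sum `s` times the denominator product equals the numerator
  -- product.
  have h2 := h1.unique (hasSum_substTerm_prod (diagram lam).cells (content α))
  have hy := y_ne_zero
  have h3 : ∀ z : FormalField, risingFactorial α lam z =
      y ^ n * ∏ c ∈ (diagram lam).cells, (z / y + const (content α c) / y) := by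
    intro z
    have h4 : y ^ n = ∏ _c ∈ (diagram lam).cells, y := by
      rw [prod_const, card_diagram]
    rw [risingFactorial, h4, ← prod_mul_distrib]
    exact prod_congr rfl fun c _ => by field_simp
  convert hs using 1
  have h5 : risingFactorial α lam y ≠ 0 := prod_ne_zero_iff.2 fun c _ => y_add_const_ne_zero _
  rw [div_eq_iff h5, h3, h3, div_self hy,
    sub_div, div_self hy, ← h2]
  ring

end Evaluation

end JackExpansion

theorem mainTheorem3 (α : ℝ) (hα : 0 < α) (n : ℕ) (lam : n.Partition) :
    HasSum
      (fun p : ℕ × ℕ =>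
        (-1 : JackExpansion.FormalField) ^ (p.1 + p.2) *
          (JackExpansion.x ^ p.1 / JackExpansion.y ^ (p.1 + p.2)) *
          JackExpansion.const
            (∑ k ∈ Finset.range (min p.1 p.2 + 1),
              ((Ring.choose ((n : ℤ) - (p.2 : ℤ)) (p.1 - k) : ℤ) : ℝ) *
                JackExpansion.F α p.2 k lam))
      (JackExpansion.risingFactorial α lam (JackExpansion.y - JackExpansion.x) /
        JackExpansion.risingFactorial α lam JackExpansion.y) := by
  convert JackExpansion.hasSum_expansion α lam using 2 with p
  rw [JackExpansion.substTerm_eq, JackExpansion.expansion, PowerSeries.coeff_mk,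
    PowerSeries.coeff_mk]
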